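/- Let $\mathbb{C}_+=\{w\in\mathbb{C}:\operatorname{Re}w>0\}$ and let $H^2(\mathbb{C}_+)$ be the Hardy space of all holomorphic $f:\mathbb{C}_+\to\mathbb{C}$ with $$\|f\|=\Big(\sup_{x>0}\frac1\pi\int_{-\infty}^{\infty}|f(x+iy)|^2\,dy\Big)^{1/2}<\infty ,$$ which is a Hilbert space for the inner product inducing this norm. A bounded linear operator $T$ on a complex Hilbert space $\mathcal{H}$ is called complex symmetric if there is a conjugate-linear map $C:\mathcal{H}\to\mathcal{H}$ with $C^2=I$ and $\langle Cx,Cy\rangle=\langle y,x\rangle$ for all $x,y\in\mathcal{H}$ such that $CT^*C=T$. Let $a>0$ be real, let $b\in\mathbb{C}$ with $\operatorname{Re}b\ge 0$, let $\phi:\mathbb{C}_+\to\mathbb{C}_+$ be the map $\phi(w)=aw+b$, and let $C_\phi f=f\circ\phi$ be the associated (bounded) composition operator on $H^2(\mathbb{C}_+)$. Then $C_\phi$ is complex symmetric if and only if $a=1$ or $\operatorname{Re}(b)=0$. -/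

import Mathlib

namespace HardyRHP

open MeasureTheory Set Filter Topology
open scoped ENNReal NNReal ComplexConjugate

/-- Squared `L²` size of `F` on the vertical line `Re w = x`: `∫ |F(x + iy)|² dy`. -/
noncomputable def lineSq (F : ℂ → ℂ) (x : ℝ) : ℝ≥0∞ :=
  ∫⁻ y : ℝ, ‖F (x + y * Complex.I)‖ₑ ^ 2

theorem isOpen_re_pos : IsOpen {w : ℂ | 0 < w.re} :=
  isOpen_lt continuous_const Complex.continuous_re

theorem continuous_line {F : ℂ → ℂ} (hF : DifferentiableOn ℂ F {w | 0 < w.re}) {w : ℂ}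
    (hw : 0 < w.re) : Continuous fun t : ℝ => F (w + t * Complex.I) := by
  refine hF.continuousOn.comp_continuous (by fun_prop) fun t => ?_
  simpa using hw

theorem hasDerivAt_param {F : ℂ → ℂ} (hF : DifferentiableOn ℂ F {w | 0 < w.re})
    {h : ℝ → ℂ} (hh : Continuous h) (α β : ℝ) {w : ℂ} (hw : 0 < w.re) :
    HasDerivAt (fun z : ℂ => ∫ t in α..β, F (z + t * Complex.I) * h t)
      (∫ t in α..β, deriv F (w + t * Complex.I) * h t) w := by
  have hF' : DifferentiableOn ℂ (deriv F) {w | 0 < w.re} := hF.deriv isOpen_re_pos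
  have hsub : Metric.closedBall w (w.re / 2) ⊆ {z : ℂ | 0 < z.re} := by
    intro z hz
    have h1 : |(z - w).re| ≤ w.re / 2 :=
      (Complex.abs_re_le_norm _).trans (by simpa [dist_eq_norm] using hz)
    have h2 := (abs_le.1 h1).1
    simp only [Complex.sub_re] at h2
    simp only [mem_ofPred_eq]; linarith
  have hK : IsCompact (Metric.closedBall w (w.re / 2) ×ˢ uIcc α β) :=
    (isCompact_closedBall _ _).prod isCompact_uIcc
  have hc : ContinuousOn (fun p : ℂ × ℝ => deriv F (p.1 + p.2 * Complex.I) * h p.2)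
      (Metric.closedBall w (w.re / 2) ×ˢ uIcc α β) := by
    refine ContinuousOn.mul (hF'.continuousOn.comp (by fun_prop) ?_) (by fun_prop)
    rintro ⟨z, t⟩ ⟨hz, -⟩
    simpa using hsub hz
  obtain ⟨C, hC⟩ := hK.exists_bound_of_continuousOn hc
  refine (intervalIntegral.hasDerivAt_integral_of_dominated_loc_of_deriv_le
    (F := fun (z : ℂ) (t : ℝ) => F (z + t * Complex.I) * h t)
    (F' := fun (z : ℂ) (t : ℝ) => deriv F (z + t * Complex.I) * h t)
    (bound := fun _ => C) (Metric.closedBall_mem_nhds w (half_pos hw)) ?_ ?_ ?_ ?_ ?_ ?_).2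
  · filter_upwards [isOpen_re_pos.mem_nhds hw] with z hz
    exact ((continuous_line hF hz).mul hh).aestronglyMeasurable
  · exact ((continuous_line hF hw).mul hh).intervalIntegrable _ _
  · exact ((continuous_line hF' hw).mul hh).aestronglyMeasurable
  · exact Eventually.of_forall fun t ht z hz => hC (z, t) ⟨hz, uIoc_subset_uIcc ht⟩
  · exact intervalIntegrable_const
  · refine Eventually.of_forall fun t ht z hz => HasDerivAt.mul_const ?_ _
    have hz' : 0 < (z + t * Complex.I).re := by simpa using hsub hz
    exact ((hF.differentiableAt (isOpen_re_pos.mem_nhds hz')).hasDerivAt).comp_add_const z _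

theorem integral_line_le {F : ℂ → ℂ} (hF : DifferentiableOn ℂ F {w | 0 < w.re}) {w : ℂ}
    (hw : 0 < w.re) {B : ℝ} (hB0 : 0 ≤ B) (hB : lineSq F w.re ≤ ENNReal.ofReal B)
    {α β : ℝ} (hαβ : α ≤ β) : ∫ t in α..β, ‖F (w + t * Complex.I)‖ ^ 2 ≤ B := by
  rw [← ENNReal.ofReal_le_ofReal_iff hB0, intervalIntegral.integral_of_le hαβ,
    ofReal_integral_eq_lintegral_ofReal]
  · refine le_trans ?_ hB
    calc _ ≤ ∫⁻ t : ℝ, ENNReal.ofReal (‖F (w + t * Complex.I)‖ ^ 2) := setLIntegral_le_lintegral _ _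
      _ = ∫⁻ t : ℝ, (fun y : ℝ => ‖F (w.re + y * Complex.I)‖ₑ ^ 2) (t + w.im) := by
        refine lintegral_congr fun t => ?_
        rw [ENNReal.ofReal_pow (norm_nonneg _), ofReal_norm]
        congr 3
        apply Complex.ext <;> simp [add_comm]
      _ = lineSq F w.re := lintegral_add_right_eq_self
        (fun y : ℝ => ‖F (w.re + y * Complex.I)‖ₑ ^ 2) w.im
  · exact (((continuous_line hF hw).norm.pow 2).intervalIntegrable α β).1
  · exact Eventually.of_forall fun _ => by positivity

theorem norm_integral_mul_le {u v : ℝ → ℂ} (hu : Continuous u) (hv : Continuous v) {α β : ℝ}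
    (h : α ≤ β) : ‖∫ t in α..β, u t * v t‖ ≤
      ((∫ t in α..β, ‖u t‖ ^ 2) + ∫ t in α..β, ‖v t‖ ^ 2) / 2 := by
  have hu2 : Continuous fun t => ‖u t‖ ^ 2 := hu.norm.pow 2
  have hv2 : Continuous fun t => ‖v t‖ ^ 2 := hv.norm.pow 2
  rw [← intervalIntegral.integral_add (hu2.intervalIntegrable _ _)
    (hv2.intervalIntegrable _ _), ← intervalIntegral.integral_div]
  refine intervalIntegral.norm_integral_le_of_norm_le h (Eventually.of_forall fun t _ => ?_)
    (Continuous.intervalIntegrable (by fun_prop) _ _)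
  rw [norm_mul]
  nlinarith [sq_nonneg (‖u t‖ - ‖v t‖)]

/-- For `F` holomorphic on the half-plane with bounded line integrals, the line integrals
decrease with `x` (by the Phragmén–Lindelöf principle). -/
theorem lineSq_anti {F : ℂ → ℂ} (hF : DifferentiableOn ℂ F {w | 0 < w.re}) {B : ℝ}
    (hB0 : 0 ≤ B) (hB : ∀ x : ℝ, 0 < x → lineSq F x ≤ ENNReal.ofReal B)
    {x₀ x₁ : ℝ} (h0 : 0 < x₀) (h01 : x₀ ≤ x₁) : lineSq F x₁ ≤ lineSq F x₀ := by
  obtain ⟨M, hM0, hM⟩ : ∃ M : ℝ, 0 ≤ M ∧ lineSq F x₀ = ENNReal.ofReal M :=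
    ⟨(lineSq F x₀).toReal, ENNReal.toReal_nonneg,
      (ENNReal.ofReal_toReal ((hB x₀ h0).trans_lt ENNReal.ofReal_lt_top).ne).symm⟩
  have h1 : 0 < x₁ := h0.trans_le h01
  have hc1 : Continuous fun t : ℝ => F (x₁ + t * Complex.I) := by
    simpa using continuous_line hF (w := (x₁ : ℂ)) (by simpa using h1)
  have hcc : Continuous fun t : ℝ => conj (F (x₁ + t * Complex.I)) :=
    Complex.continuous_conj.comp hc1
  have key : ∀ R : ℝ, 0 ≤ R → ∫ t in -R..R, ‖F (x₁ + t * Complex.I)‖ ^ 2 ≤ M := by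
    intro R hR
    have hRR : -R ≤ R := by linarith
    set m := ∫ t in -R..R, ‖F (x₁ + t * Complex.I)‖ ^ 2 with hm
    set G : ℂ → ℂ := fun z => ∫ t in -R..R, F (z + t * Complex.I) *
      conj (F (x₁ + t * Complex.I)) with hG
    have hGd : ∀ z : ℂ, 0 < z.re → DifferentiableAt ℂ G z := fun z hz =>
      (hasDerivAt_param hF hcc (-R) R hz).differentiableAt
    have hGb : ∀ z : ℂ, 0 < z.re → ∀ A : ℝ, 0 ≤ A → lineSq F z.re ≤ ENNReal.ofReal A →
        ‖G z‖ ≤ (A + m) / 2 := by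
      intro z hz A hA0 hA
      refine (norm_integral_mul_le (continuous_line hF hz) hcc hRR).trans ?_
      have := integral_line_le hF hz hA0 hA hRR
      simp only [RCLike.norm_conj]
      linarith
    have hpl := PhragmenLindelof.right_half_plane_of_bounded_on_real
      (f := fun z => G (x₀ + z)) (C := (M + m) / 2) (z := ((x₁ - x₀ : ℝ) : ℂ)) ?_ ?_ ?_ ?_ ?_
    · have hval : G x₁ = (m : ℂ) := by
        rw [hG, hm, ← intervalIntegral.integral_ofReal]
        refine intervalIntegral.integral_congr fun t _ => ?_
        simp [Complex.mul_conj, Complex.normSq_eq_norm_sq]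
      have hx : (x₀ : ℂ) + ((x₁ - x₀ : ℝ) : ℂ) = x₁ := by push_cast; ring
      simp only [hx, hval, Complex.norm_real] at hpl
      have := (le_abs_self m).trans hpl
      linarith
    · apply DifferentiableOn.diffContOnCl
      rw [Complex.closure_setOfPred_lt_re]
      intro z hz
      have hz' : 0 < ((x₀ : ℂ) + z).re := by
        simp only [mem_ofPred_eq] at hz
        simp; linarith
      exact ((hGd _ hz').comp z (by fun_prop : DifferentiableAt ℂ (fun z => (x₀ : ℂ) + z) z)).differentiableWithinAt
    · refine ⟨1, by norm_num, 0, ?_⟩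
      refine Asymptotics.IsBigO.of_bound ((B + m) / 2) ?_
      refine eventually_inf_principal.2 (Eventually.of_forall fun z hz => ?_)
      have hz' : 0 < ((x₀ : ℂ) + z).re := by
        simp only [mem_ofPred_eq] at hz
        simp; linarith
      simpa using hGb _ hz' B hB0 (hB _ hz')
    · refine isBoundedUnder_of_eventually_le (a := (B + m) / 2) ?_
      filter_upwards [eventually_ge_atTop 0] with x hx
      have hz' : 0 < ((x₀ : ℂ) + x).re := by simp; linarith
      exact hGb _ hz' B hB0 (hB _ hz')
    · intro y
      refine hGb _ (by simpa using h0) M hM0 ?_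
      simp [hM]
    · simpa using h01
  rw [hM]
  have hlim := (aecover_Ioc (μ := (volume : Measure ℝ)) tendsto_neg_atTop_atBot
    (tendsto_id (α := ℝ) (x := atTop))).lintegral_tendsto_of_countably_generated
    (f := fun y : ℝ => ‖F (x₁ + y * Complex.I)‖ₑ ^ 2)
    (hc1.enorm.measurable.pow_const 2).aemeasurable
  refine le_of_tendsto hlim ?_
  filter_upwards [eventually_ge_atTop 0] with R hR
  have hk := ENNReal.ofReal_le_ofReal (key R hR)
  rw [intervalIntegral.integral_of_le (by linarith), ofReal_integral_eq_lintegral_ofReal] at hk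
  · refine le_trans (le_of_eq (lintegral_congr fun t => ?_)) hk
    rw [ENNReal.ofReal_pow (norm_nonneg _), ofReal_norm]
  · exact ((hc1.norm.pow 2).intervalIntegrable (-R) R).1
  · exact Eventually.of_forall fun _ => by positivity

/-- Point evaluations are controlled by the line integrals. -/
theorem norm_le_of_lineSq_le {F : ℂ → ℂ} (hF : DifferentiableOn ℂ F {w | 0 < w.re}) {c : ℝ}
    (hc : 0 < c) (hB : ∀ x : ℝ, 0 < x → lineSq F x ≤ ENNReal.ofReal (c ^ 2)) {w : ℂ} {r : ℝ}
    (hr : 0 < r) (hrw : r < w.re) : ‖F w‖ ≤ c * (1 + 1 / r) := by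
  have hw : 0 < w.re := hr.trans hrw
  have hL1 : ∀ z : ℂ, 0 < z.re → ∀ s ∈ Icc (0 : ℝ) 1,
      ‖∫ t in (0 : ℝ)..s, F (z + t * Complex.I)‖ ≤ c := by
    intro z hz s hs
    have hcz : Continuous fun t : ℝ => ‖F (z + t * Complex.I)‖ ^ 2 / c :=
      ((continuous_line hF hz).norm.pow 2).div_const c
    have h1 : ‖∫ t in (0 : ℝ)..s, F (z + t * Complex.I)‖ ≤
        ∫ t in (0 : ℝ)..s, (c + ‖F (z + t * Complex.I)‖ ^ 2 / c) / 2 := by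
      refine intervalIntegral.norm_integral_le_of_norm_le hs.1 (Eventually.of_forall fun t _ => ?_)
        (((continuous_const.add hcz).div_const 2).intervalIntegrable _ _)
      have : (c + ‖F (z + t * Complex.I)‖ ^ 2 / c) / 2 - ‖F (z + t * Complex.I)‖ =
        (c - ‖F (z + t * Complex.I)‖) ^ 2 / (2 * c) := by field_simp; ring
      have h2 : 0 ≤ (c - ‖F (z + t * Complex.I)‖) ^ 2 / (2 * c) := by positivity
      linarith
    rw [intervalIntegral.integral_div, intervalIntegral.integral_add intervalIntegrable_const
      (hcz.intervalIntegrable _ _), intervalIntegral.integral_div,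
      intervalIntegral.integral_const] at h1
    have h2 := integral_line_le hF hz (sq_nonneg c) (hB _ hz) hs.1
    have h3 : (∫ t in (0 : ℝ)..s, ‖F (z + t * Complex.I)‖ ^ 2) / c ≤ c := by
      rw [div_le_iff₀ hc]; linarith [sq c]
    have h4 : (s - 0) • c ≤ c := by
      rw [smul_eq_mul]; nlinarith [hs.1, hs.2]
    linarith
  have hdiff : ∀ s ∈ Icc (0 : ℝ) 1, ‖F w - F (w + s * Complex.I)‖ ≤ c / r := by
    intro s hs
    have hd : ∀ z : ℂ, 0 < z.re → HasDerivAt (fun z : ℂ => ∫ t in (0 : ℝ)..s, F (z + t * Complex.I))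
        (∫ t in (0 : ℝ)..s, deriv F (z + t * Complex.I)) z := by
      intro z hz
      simpa using hasDerivAt_param hF (h := fun _ => 1) continuous_const 0 s hz
    have hsub : Metric.closedBall w r ⊆ {z : ℂ | 0 < z.re} := by
      intro z hz
      have h1 : |(z - w).re| ≤ r :=
        (Complex.abs_re_le_norm _).trans (by simpa [dist_eq_norm] using hz)
      have h2 := (abs_le.1 h1).1
      simp only [Complex.sub_re] at h2
      simp only [mem_ofPred_eq]; linarith
    have hcauchy := Complex.norm_deriv_le_of_forall_mem_sphere_norm_le (c := w) (R := r) (C := c)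
      (f := fun z : ℂ => ∫ t in (0 : ℝ)..s, F (z + t * Complex.I)) hr
      (DifferentiableOn.diffContOnCl_ball (U := {z : ℂ | 0 < z.re})
        (fun z hz => (hd z hz).differentiableAt.differentiableWithinAt) hsub)
      (fun z hz => hL1 z (hsub (Metric.sphere_subset_closedBall hz)) s hs)
    rw [(hd w hw).deriv] at hcauchy
    have hftc : ∫ t in (0 : ℝ)..s, deriv F (w + t * Complex.I) * Complex.I =
        F (w + s * Complex.I) - F (w + (0 : ℝ) * Complex.I) := by
      refine intervalIntegral.integral_eq_sub_of_hasDerivAt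
        (f := fun t : ℝ => F (w + t * Complex.I)) (fun t _ => ?_) ?_
      · have hz' : 0 < (w + t * Complex.I).re := by simpa using hw
        have h1 := (hF.differentiableAt (isOpen_re_pos.mem_nhds hz')).hasDerivAt
        have h2 : HasDerivAt (fun t : ℝ => w + (t : ℂ) * Complex.I) Complex.I t := by
          simpa using ((Complex.ofRealCLM.hasDerivAt (x := t)).mul_const Complex.I).const_add w
        exact h1.comp t h2
      · exact ((continuous_line (hF.deriv isOpen_re_pos) hw).mul continuous_const).intervalIntegrable
          _ _
    rw [intervalIntegral.integral_mul_const] at hftc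
    have : ‖F w - F (w + s * Complex.I)‖ =
        ‖∫ t in (0 : ℝ)..s, deriv F (w + t * Complex.I)‖ := by
      rw [norm_sub_rev]
      have := congrArg norm hftc
      simpa using this.symm
    rw [this]; exact hcauchy
  have hsum : F w = (∫ t in (0 : ℝ)..1, F (w + t * Complex.I)) +
      ∫ t in (0 : ℝ)..1, (F w - F (w + t * Complex.I)) := by
    rw [intervalIntegral.integral_sub intervalIntegrable_const
      ((continuous_line hF hw).intervalIntegrable _ _)]
    simp
  have hb2 : ‖∫ t in (0 : ℝ)..1, (F w - F (w + t * Complex.I))‖ ≤ c / r * |1 - 0| := by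
    refine intervalIntegral.norm_integral_le_of_norm_le_const fun t ht => ?_
    rw [uIoc_of_le zero_le_one] at ht
    exact hdiff t ⟨ht.1.le, ht.2⟩
  have hb1 := hL1 w hw 1 ⟨zero_le_one, le_rfl⟩
  rw [hsum]
  refine (norm_add_le _ _).trans ?_
  have : c * (1 + 1 / r) = c + c / r := by ring
  rw [this]
  simp only [sub_zero, abs_one, mul_one] at hb2
  linarith


/-- The open right half-plane `ℂ₊ = {w : Re w > 0}`. -/
abbrev HalfPlane : Type := {w : ℂ // 0 < w.re}

/-- The extension by zero of a function on `ℂ₊` to the whole plane, a device for speaking about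
holomorphy and line integrals; only its values on `ℂ₊` are ever used. -/
noncomputable def ext (f : HalfPlane → ℂ) (w : ℂ) : ℂ :=
  open Classical in if h : 0 < w.re then f ⟨w, h⟩ else 0

theorem ext_apply (f : HalfPlane → ℂ) {w : ℂ} (h : 0 < w.re) : ext f w = f ⟨w, h⟩ := by
  simp [ext, h]

theorem ext_coe (f : HalfPlane → ℂ) (w : HalfPlane) : ext f w = f w := ext_apply f w.2

theorem ext_add (f g : HalfPlane → ℂ) : ext (f + g) = ext f + ext g := by
  funext w; by_cases h : 0 < w.re <;> simp [ext, h]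

theorem ext_sub (f g : HalfPlane → ℂ) : ext (f - g) = ext f - ext g := by
  funext w; by_cases h : 0 < w.re <;> simp [ext, h]

theorem ext_smul (c : ℂ) (f : HalfPlane → ℂ) : ext (c • f) = c • ext f := by
  funext w; by_cases h : 0 < w.re <;> simp [ext, h]

/-- `f` is holomorphic on `ℂ₊`. -/
def IsHolomorphic (f : HalfPlane → ℂ) : Prop := DifferentiableOn ℂ (ext f) {w | 0 < w.re}

/-- The square of the Hardy norm: `sup_{x > 0} (1/π) ∫ |f(x + iy)|² dy`. -/
noncomputable def hardySq (f : HalfPlane → ℂ) : ℝ≥0∞ :=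
  ⨆ x : Ioi (0 : ℝ), ENNReal.ofReal (1 / Real.pi) * lineSq (ext f) x

theorem lineSq_add_le {F G : ℂ → ℂ} (hF : DifferentiableOn ℂ F {w | 0 < w.re}) {x : ℝ}
    (hx : 0 < x) {t : ℝ} (ht : 0 < t) : lineSq (F + G) x ≤
      ENNReal.ofReal (1 + t) * lineSq F x + ENNReal.ofReal (1 + 1 / t) * lineSq G x := by
  have hc : Continuous fun y : ℝ => F (x + y * Complex.I) :=
    continuous_line hF (w := (x : ℂ)) (by simpa using hx)
  unfold lineSq
  rw [← lintegral_const_mul' _ _ ENNReal.ofReal_ne_top,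
    ← lintegral_const_mul' _ _ ENNReal.ofReal_ne_top,
    ← lintegral_add_left ((hc.enorm.measurable.pow_const 2).const_mul _)]
  refine lintegral_mono fun y => ?_
  simp only [Pi.add_apply, ← ofReal_norm, ← ENNReal.ofReal_pow (norm_nonneg _)]
  rw [← ENNReal.ofReal_mul (by positivity), ← ENNReal.ofReal_mul (by positivity),
    ← ENNReal.ofReal_add (by positivity) (by positivity)]
  refine ENNReal.ofReal_le_ofReal ?_
  set p := F (x + y * Complex.I)
  set q := G (x + y * Complex.I)
  have h1 : ‖p + q‖ ^ 2 ≤ (‖p‖ + ‖q‖) ^ 2 := by gcongr; exact norm_add_le p q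
  have h2 : (1 + t) * ‖p‖ ^ 2 + (1 + 1 / t) * ‖q‖ ^ 2 - (‖p‖ + ‖q‖) ^ 2 =
      (t * ‖p‖ - ‖q‖) ^ 2 / t := by field_simp; ring
  have h3 : 0 ≤ (t * ‖p‖ - ‖q‖) ^ 2 / t := by positivity
  linarith

theorem lineSq_smul (c : ℂ) (F : ℂ → ℂ) (x : ℝ) : lineSq (c • F) x = ‖c‖ₑ ^ 2 * lineSq F x := by
  unfold lineSq
  rw [← lintegral_const_mul' _ _ (by finiteness)]
  refine lintegral_congr fun y => ?_
  simp [enorm_mul, mul_pow]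

theorem hardySq_add_le {f g : HalfPlane → ℂ} (hf : IsHolomorphic f) {t : ℝ} (ht : 0 < t) :
    hardySq (f + g) ≤ ENNReal.ofReal (1 + t) * hardySq f + ENNReal.ofReal (1 + 1 / t) * hardySq g := by
  refine iSup_le fun x => ?_
  rw [ext_add]
  calc _ ≤ ENNReal.ofReal (1 / Real.pi) * (ENNReal.ofReal (1 + t) * lineSq (ext f) x +
        ENNReal.ofReal (1 + 1 / t) * lineSq (ext g) x) := by
        gcongr; exact lineSq_add_le hf x.2 ht
    _ = ENNReal.ofReal (1 + t) * (ENNReal.ofReal (1 / Real.pi) * lineSq (ext f) x) +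
        ENNReal.ofReal (1 + 1 / t) * (ENNReal.ofReal (1 / Real.pi) * lineSq (ext g) x) := by ring
    _ ≤ _ := by
        gcongr
        · exact le_iSup (fun x : Ioi (0 : ℝ) => ENNReal.ofReal (1 / Real.pi) * lineSq (ext f) x) x
        · exact le_iSup (fun x : Ioi (0 : ℝ) => ENNReal.ofReal (1 / Real.pi) * lineSq (ext g) x) x

theorem hardySq_smul (c : ℂ) (f : HalfPlane → ℂ) : hardySq (c • f) = ‖c‖ₑ ^ 2 * hardySq f := by
  unfold hardySq
  rw [ENNReal.mul_iSup]
  refine iSup_congr fun x => ?_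
  rw [ext_smul, lineSq_smul]; ring

/-- The Hardy space `H²(ℂ₊)` as a space of functions: `f` is holomorphic on `ℂ₊` and
`sup_{x > 0} (1/π) ∫ |f(x + iy)|² dy < ∞`. -/
noncomputable def hardySubmodule : Submodule ℂ (HalfPlane → ℂ) where
  carrier := {f | IsHolomorphic f ∧ hardySq f < ⊤}
  zero_mem' := by
    have h0 : ext (0 : HalfPlane → ℂ) = 0 := by funext w; simp [ext]
    refine ⟨?_, ?_⟩
    · unfold IsHolomorphic; rw [h0]; exact differentiableOn_const 0
    · simp [hardySq, h0, lineSq]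
  add_mem' := by
    rintro f g ⟨hf, hf'⟩ ⟨hg, hg'⟩
    refine ⟨?_, (hardySq_add_le hf one_pos).trans_lt (by finiteness)⟩
    unfold IsHolomorphic; rw [ext_add]; exact hf.add hg
  smul_mem' := by
    rintro c f ⟨hf, hf'⟩
    refine ⟨?_, ?_⟩
    · unfold IsHolomorphic; rw [ext_smul]; exact hf.const_smul c
    · rw [hardySq_smul]; finiteness

/-- The Hardy space `H²(ℂ₊)`; it carries the topology of the Hardy norm below. -/
def H2 : Type := hardySubmodule

namespace H2

noncomputable instance : AddCommGroup H2 := inferInstanceAs (AddCommGroup hardySubmodule)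

noncomputable instance : Module ℂ H2 := inferInstanceAs (Module ℂ hardySubmodule)

/-- The function underlying an element of `H²(ℂ₊)`. -/
def toFun (f : H2) : HalfPlane → ℂ := (show hardySubmodule from f).1

instance : CoeFun H2 fun _ => HalfPlane → ℂ := ⟨toFun⟩

/-- An element of `H²(ℂ₊)` from a function. -/
def mk (f : HalfPlane → ℂ) (hf : f ∈ hardySubmodule) : H2 := (⟨f, hf⟩ : hardySubmodule)

theorem mem (f : H2) : (f : HalfPlane → ℂ) ∈ hardySubmodule := (show hardySubmodule from f).2

theorem coe_mk (f : HalfPlane → ℂ) (hf : f ∈ hardySubmodule) : (mk f hf : HalfPlane → ℂ) = f := rfl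

@[ext] theorem ext' {f g : H2} (h : ∀ w, f w = g w) : f = g := Subtype.ext (funext h)

theorem coe_zero : ((0 : H2) : HalfPlane → ℂ) = 0 := rfl

theorem coe_add (f g : H2) : ((f + g : H2) : HalfPlane → ℂ) = f + g := rfl

theorem coe_sub (f g : H2) : ((f - g : H2) : HalfPlane → ℂ) = f - g := rfl

theorem coe_smul (c : ℂ) (f : H2) : ((c • f : H2) : HalfPlane → ℂ) = c • (f : HalfPlane → ℂ) := rfl

theorem hol (f : H2) : DifferentiableOn ℂ (HardyRHP.ext f) {w | 0 < w.re} := f.mem.1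

/-- The Hardy norm `‖f‖ = (sup_{x > 0} (1/π) ∫ |f(x + iy)|² dy)^{1/2}`. -/
noncomputable instance : Norm H2 := ⟨fun f => Real.sqrt (hardySq f).toReal⟩

theorem norm_def (f : H2) : ‖f‖ = Real.sqrt (hardySq f).toReal := rfl

theorem ofReal_norm_sq (f : H2) : ENNReal.ofReal (‖f‖ ^ 2) = hardySq f := by
  rw [norm_def, Real.sq_sqrt ENNReal.toReal_nonneg, ENNReal.ofReal_toReal f.mem.2.ne]

theorem norm_nonneg' (f : H2) : 0 ≤ ‖f‖ := Real.sqrt_nonneg _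

theorem norm_le_iff (f : H2) {c : ℝ} (hc : 0 ≤ c) : ‖f‖ ≤ c ↔ hardySq f ≤ ENNReal.ofReal (c ^ 2) := by
  rw [← ofReal_norm_sq, ENNReal.ofReal_le_ofReal_iff (by positivity),
    sq_le_sq₀ (norm_nonneg' f) hc]

theorem lineSq_le (f : H2) {x : ℝ} (hx : 0 < x) :
    lineSq (HardyRHP.ext f) x ≤ ENNReal.ofReal (Real.pi * ‖f‖ ^ 2) := by
  have h : ENNReal.ofReal (1 / Real.pi) * lineSq (HardyRHP.ext f) x ≤ hardySq f :=
    le_iSup (fun x : Ioi (0 : ℝ) => ENNReal.ofReal (1 / Real.pi) * lineSq (HardyRHP.ext f) x) ⟨x, hx⟩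
  calc lineSq (HardyRHP.ext f) x
      = ENNReal.ofReal Real.pi * (ENNReal.ofReal (1 / Real.pi) * lineSq (HardyRHP.ext f) x) := by
        rw [← mul_assoc, ← ENNReal.ofReal_mul Real.pi_pos.le, mul_one_div_cancel Real.pi_ne_zero]
        simp
    _ ≤ ENNReal.ofReal Real.pi * hardySq f := by gcongr
    _ = _ := by rw [ENNReal.ofReal_mul Real.pi_pos.le, ofReal_norm_sq]

theorem norm_apply_le (f : H2) (w : HalfPlane) {r : ℝ} (hr : 0 < r) (hrw : r < (w : ℂ).re) :
    ‖f w‖ ≤ Real.sqrt Real.pi * ‖f‖ * (1 + 1 / r) := by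
  have hlim : Tendsto (fun c : ℝ => c * (1 + 1 / r)) (𝓝[>] (Real.sqrt Real.pi * ‖f‖))
      (𝓝 (Real.sqrt Real.pi * ‖f‖ * (1 + 1 / r))) :=
    (Continuous.tendsto (by fun_prop) _).mono_left nhdsWithin_le_nhds
  have hs : 0 ≤ Real.sqrt Real.pi * ‖f‖ := mul_nonneg (Real.sqrt_nonneg _) (norm_nonneg' f)
  refine ge_of_tendsto hlim ?_
  filter_upwards [self_mem_nhdsWithin] with c hc
  rw [← ext_coe f w]
  refine norm_le_of_lineSq_le f.hol (hs.trans_lt hc) (fun x hx => (f.lineSq_le hx).trans ?_) hr hrw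
  refine ENNReal.ofReal_le_ofReal ?_
  have h := pow_le_pow_left₀ hs (le_of_lt hc) 2
  rwa [mul_pow, Real.sq_sqrt Real.pi_pos.le] at h

theorem norm_add_le' (f g : H2) : ‖f + g‖ ≤ ‖f‖ + ‖g‖ := by
  refine le_of_forall_pos_le_add fun ε hε => ?_
  have hA : 0 < ‖f‖ + ε / 2 := by have := norm_nonneg' f; positivity
  have hB : 0 < ‖g‖ + ε / 2 := by have := norm_nonneg' g; positivity
  have hf := (norm_le_iff f hA.le).1 (by linarith)
  have hg := (norm_le_iff g hB.le).1 (by linarith)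
  set A := ‖f‖ + ε / 2
  set B := ‖g‖ + ε / 2
  have key : ‖f + g‖ ≤ A + B := by
    rw [norm_le_iff _ (by positivity), coe_add]
    refine (hardySq_add_le f.mem.1 (div_pos hB hA)).trans ?_
    calc _ ≤ ENNReal.ofReal (1 + B / A) * ENNReal.ofReal (A ^ 2) +
          ENNReal.ofReal (1 + 1 / (B / A)) * ENNReal.ofReal (B ^ 2) := by gcongr
      _ = _ := by
        rw [← ENNReal.ofReal_mul (by positivity), ← ENNReal.ofReal_mul (by positivity),
          ← ENNReal.ofReal_add (by positivity) (by positivity)]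
        congr 1
        field_simp
        ring
  refine key.trans (le_of_eq ?_)
  change ‖f‖ + ε / 2 + (‖g‖ + ε / 2) = _
  ring

theorem normedSpaceCore : NormedSpace.Core ℂ H2 where
  norm_nonneg := norm_nonneg'
  norm_smul c f := by
    rw [norm_def, norm_def, coe_smul, hardySq_smul, ENNReal.toReal_mul, Real.sqrt_mul' _
      ENNReal.toReal_nonneg]
    simp
  norm_triangle := norm_add_le'
  norm_eq_zero_iff f := by
    constructor
    · intro h
      ext w
      have := f.norm_apply_le w (half_pos w.2) (half_lt_self w.2)
      rw [h] at this
      rw [coe_zero]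
      simpa using this
    · rintro rfl
      have h := ext_smul 0 (0 : HalfPlane → ℂ)
      have h2 := hardySq_smul 0 (0 : HalfPlane → ℂ)
      simp only [smul_zero, enorm_zero] at h2
      rw [norm_def]
      change Real.sqrt (hardySq (0 : HalfPlane → ℂ)).toReal = 0
      rw [h2]; simp

noncomputable instance : NormedAddCommGroup H2 := NormedAddCommGroup.ofCore normedSpaceCore

noncomputable instance : NormedSpace ℂ H2 := NormedSpace.ofCore normedSpaceCore

theorem parallelogram (f g : H2) :
    ‖f + g‖ * ‖f + g‖ + ‖f - g‖ * ‖f - g‖ = 2 * (‖f‖ * ‖f‖ + ‖g‖ * ‖g‖) := by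
  have anti : ∀ h : H2, Antitone fun x : Ioi (0 : ℝ) =>
      ENNReal.ofReal (1 / Real.pi) * lineSq (HardyRHP.ext h) x := by
    intro h x y hxy
    dsimp only
    gcongr
    exact lineSq_anti h.hol (by positivity) (fun x hx => h.lineSq_le hx) x.2 hxy
  have hsup : ∀ h k : H2, hardySq h + hardySq k = ⨆ x : Ioi (0 : ℝ),
      (ENNReal.ofReal (1 / Real.pi) * lineSq (HardyRHP.ext h) x +
        ENNReal.ofReal (1 / Real.pi) * lineSq (HardyRHP.ext k) x) := by
    intro h k
    refine ENNReal.iSup_add_iSup fun i j => ⟨i ⊓ j, ?_⟩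
    exact add_le_add (anti h inf_le_left) (anti k inf_le_right)
  have hline : ∀ x : Ioi (0 : ℝ), lineSq (HardyRHP.ext (f + g : H2)) x +
      lineSq (HardyRHP.ext (f - g : H2)) x =
      2 * (lineSq (HardyRHP.ext f) x + lineSq (HardyRHP.ext g) x) := by
    intro x
    have hx : 0 < ((x : ℝ) : ℂ).re := x.2
    have hm : ∀ h : H2, Measurable fun y : ℝ => ‖HardyRHP.ext h (x + y * Complex.I)‖ₑ ^ 2 := fun h =>
      (continuous_line h.hol hx).enorm.measurable.pow_const 2
    unfold lineSq
    rw [← lintegral_add_left (hm _), ← lintegral_add_left (hm _), ← lintegral_const_mul' _ _ (by simp)]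
    refine lintegral_congr fun y => ?_
    rw [coe_add, coe_sub, ext_add, ext_sub]
    simp only [Pi.add_apply, Pi.sub_apply, ← ofReal_norm, ← ENNReal.ofReal_pow (norm_nonneg _)]
    rw [← ENNReal.ofReal_add (by positivity) (by positivity),
      ← ENNReal.ofReal_add (by positivity) (by positivity),
      show (2 : ℝ≥0∞) = ENNReal.ofReal 2 by simp, ← ENNReal.ofReal_mul (by positivity)]
    congr 1
    have := parallelogram_law_with_norm ℂ (HardyRHP.ext f (x + y * Complex.I))
      (HardyRHP.ext g (x + y * Complex.I))
    linear_combination this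
  have hmain : hardySq (f + g : H2) + hardySq (f - g : H2) = 2 * (hardySq f + hardySq g) := by
    rw [hsup, hsup, ENNReal.mul_iSup]
    refine iSup_congr fun x => ?_
    rw [← mul_add, hline, ← mul_add]; ring
  have h2 : (2 : ℝ≥0∞) = ENNReal.ofReal 2 := by simp
  simp only [← ofReal_norm_sq, h2] at hmain
  rw [← ENNReal.ofReal_add (by positivity) (by positivity),
    ← ENNReal.ofReal_add (by positivity) (by positivity), ← ENNReal.ofReal_mul (by positivity),
    ENNReal.ofReal_eq_ofReal_iff (by positivity) (by positivity)] at hmain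
  linear_combination hmain

/-- The inner product inducing the Hardy norm (Jordan–von Neumann). -/
noncomputable instance : InnerProductSpace ℂ H2 := InnerProductSpace.ofNorm ℂ parallelogram

instance : CompleteSpace H2 := by
  refine Metric.complete_of_cauchySeq_tendsto fun u hu => ?_
  have hptC : ∀ w : HalfPlane, CauchySeq fun n => u n w := by
    intro w
    rw [Metric.cauchySeq_iff'] at hu ⊢
    intro ε hε
    set K := Real.sqrt Real.pi * (1 + 1 / ((w : ℂ).re / 2)) with hK
    have hK0 : 0 < K := by have := w.2; positivity
    obtain ⟨N, hN⟩ := hu (ε / K) (by positivity)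
    refine ⟨N, fun n hn => ?_⟩
    have h1 := (u n - u N).norm_apply_le w (half_pos w.2) (half_lt_self w.2)
    have h2 := hN n hn
    rw [dist_eq_norm] at h2 ⊢
    rw [lt_div_iff₀ hK0] at h2
    calc ‖u n w - u N w‖ = ‖(u n - u N) w‖ := rfl
      _ ≤ _ := h1
      _ = ‖u n - u N‖ * K := by rw [hK]; ring
      _ < ε := h2
  choose F hF using fun w => cauchySeq_tendsto_of_complete (hptC w)
  have hFe : ∀ w : ℂ, 0 < w.re → Tendsto (fun n => HardyRHP.ext (u n) w) atTop
      (𝓝 (HardyRHP.ext F w)) := by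
    intro w hw
    simp only [ext_apply _ hw]; exact hF _
  have hunif : ∀ δ : ℝ, 0 < δ → TendstoUniformlyOn (fun n => HardyRHP.ext (u n)) (HardyRHP.ext F)
      atTop {w : ℂ | δ < w.re} := by
    intro δ hδ
    refine UniformCauchySeqOn.tendstoUniformlyOn_of_tendsto ?_ fun w hw => hFe w (hδ.trans hw)
    rw [Metric.uniformCauchySeqOn_iff]
    rw [Metric.cauchySeq_iff] at hu
    intro ε hε
    set K := Real.sqrt Real.pi * (1 + 1 / δ) with hK
    have hK0 : 0 < K := by positivity
    obtain ⟨N, hN⟩ := hu (ε / K) (by positivity)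
    refine ⟨N, fun m hm n hn w hw => ?_⟩
    have hw0 : 0 < w.re := hδ.trans hw
    have h1 := (u m - u n).norm_apply_le ⟨w, hw0⟩ hδ hw
    have h2 := hN m hm n hn
    rw [dist_eq_norm] at h2 ⊢
    rw [lt_div_iff₀ hK0] at h2
    rw [ext_apply _ hw0, ext_apply _ hw0]
    calc ‖u m ⟨w, hw0⟩ - u n ⟨w, hw0⟩‖ = ‖(u m - u n) ⟨w, hw0⟩‖ := rfl
      _ ≤ _ := h1
      _ = ‖u m - u n‖ * K := by rw [hK]; ring
      _ < ε := h2
  have hFhol : IsHolomorphic F := by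
    intro w hw
    have hw : 0 < w.re := hw
    have ho : IsOpen {z : ℂ | w.re / 2 < z.re} := isOpen_lt continuous_const Complex.continuous_re
    have hd := (hunif _ (half_pos hw)).tendstoLocallyUniformlyOn.differentiableOn
      (Eventually.of_forall fun n => (u n).hol.mono fun z hz => (half_pos hw).trans hz) ho
    exact (hd.differentiableAt (ho.mem_nhds (half_lt_self hw))).differentiableWithinAt
  have hfatou : ∀ ε : ℝ, 0 < ε → ∃ N, ∀ n ≥ N, hardySq (F - u n) ≤ ENNReal.ofReal (ε ^ 2) := by
    intro ε hε
    rw [Metric.cauchySeq_iff] at hu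
    obtain ⟨N, hN⟩ := hu ε hε
    refine ⟨N, fun n hn => iSup_le fun x => ?_⟩
    have hx : 0 < ((x : ℝ) : ℂ).re := x.2
    have hle : lineSq (HardyRHP.ext (F - u n)) x ≤ ENNReal.ofReal (Real.pi * ε ^ 2) := by
      have hpt : ∀ y : ℝ, ‖HardyRHP.ext (F - u n) (x + y * Complex.I)‖ₑ ^ 2 = liminf (fun m : ℕ =>
          ‖HardyRHP.ext (u m - u n : H2) (x + y * Complex.I)‖ₑ ^ 2) atTop := by
        intro y
        have hy : 0 < ((x : ℝ) + y * Complex.I : ℂ).re := by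
          rw [Complex.add_re, Complex.ofReal_re, Complex.re_ofReal_mul, Complex.I_re, mul_zero, add_zero]
          exact x.2
        refine (Tendsto.liminf_eq ?_).symm
        refine ((ENNReal.continuous_pow 2).tendsto _).comp ?_
        refine (continuous_enorm.tendsto _).comp ?_
        simp only [coe_sub, ext_sub, Pi.sub_apply]
        exact (hFe _ hy).sub_const _
      unfold lineSq
      simp only [hpt]
      refine (lintegral_liminf_le fun m =>
        (continuous_line (u m - u n).hol hx).enorm.measurable.pow_const 2).trans ?_
      refine liminf_le_of_frequently_le' (Eventually.frequently ?_)
      filter_upwards [eventually_ge_atTop N] with m hm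
      refine ((u m - u n).lineSq_le x.2).trans (ENNReal.ofReal_le_ofReal ?_)
      have := hN m hm n hn
      rw [dist_eq_norm] at this
      gcongr
    calc _ ≤ ENNReal.ofReal (1 / Real.pi) * ENNReal.ofReal (Real.pi * ε ^ 2) := by gcongr
      _ = _ := by
        rw [← ENNReal.ofReal_mul (by positivity)]
        congr 1
        field_simp
  have hmem : F ∈ hardySubmodule := by
    obtain ⟨N, hN⟩ := hfatou 1 one_pos
    have h1 : F - u N ∈ hardySubmodule := by
      refine ⟨?_, (hN N le_rfl).trans_lt ENNReal.ofReal_lt_top⟩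
      unfold IsHolomorphic
      rw [ext_sub]
      exact DifferentiableOn.sub hFhol (u N).hol
    have h2 := hardySubmodule.add_mem h1 (u N).mem
    simpa using h2
  refine ⟨mk F hmem, ?_⟩
  rw [Metric.tendsto_atTop]
  intro ε hε
  obtain ⟨N, hN⟩ := hfatou (ε / 2) (half_pos hε)
  refine ⟨N, fun n hn => ?_⟩
  rw [dist_comm, dist_eq_norm]
  refine lt_of_le_of_lt ((norm_le_iff _ (half_pos hε).le).2 (hN n hn)) (half_lt_self hε)

end H2

/-- `φ : ℂ₊ → ℂ₊` induces a bounded composition operator on `H²(ℂ₊)`: `f ∘ φ ∈ H²(ℂ₊)` for every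
`f ∈ H²(ℂ₊)`, and `‖f ∘ φ‖² ≤ C ‖f‖²` with a constant `C`. -/
def IsBoundedSymbol (φ : HalfPlane → HalfPlane) : Prop :=
  ∃ C : ℝ≥0, ∀ f ∈ hardySubmodule, f ∘ φ ∈ hardySubmodule ∧ hardySq (f ∘ φ) ≤ C * hardySq f

/-- The composition operator `C_φ f = f ∘ φ` on `H²(ℂ₊)`. -/
noncomputable def compOp (φ : HalfPlane → HalfPlane) (hφ : IsBoundedSymbol φ) : H2 →L[ℂ] H2 where
  toFun f := H2.mk ((f : HalfPlane → ℂ) ∘ φ) (hφ.choose_spec f f.mem).1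
  map_add' _ _ := rfl
  map_smul' _ _ := rfl
  cont := by
    refine AddMonoidHomClass.continuous_of_bound
      (⟨⟨fun f : H2 => H2.mk ((f : HalfPlane → ℂ) ∘ φ) (hφ.choose_spec f f.mem).1,
        fun _ _ => rfl⟩, fun _ _ => rfl⟩ : H2 →ₗ[ℂ] H2) (Real.sqrt hφ.choose) fun f => ?_
    refine (H2.norm_le_iff _ (by positivity)).2 ((hφ.choose_spec f f.mem).2.trans ?_)
    rw [mul_pow, Real.sq_sqrt (by positivity), ENNReal.ofReal_mul (by positivity),
      H2.ofReal_norm_sq]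
    simp

theorem compOp_apply (φ : HalfPlane → HalfPlane) (hφ : IsBoundedSymbol φ) (f : H2) (w : HalfPlane) :
    compOp φ hφ f w = f (φ w) := rfl

/-- The self-map `w ↦ a w + b` of `ℂ₊`, for `a > 0` and `Re b ≥ 0`. -/
noncomputable def affineMap (a : ℝ) (b : ℂ) (ha : 0 < a) (hb : 0 ≤ b.re) (w : HalfPlane) : HalfPlane :=
  ⟨a * w + b, by have h := mul_pos ha w.2; simp; linarith⟩

theorem isBoundedSymbol_affineMap (a : ℝ) (b : ℂ) (ha : 0 < a) (hb : 0 ≤ b.re) :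
    IsBoundedSymbol (affineMap a b ha hb) := by
  have hext : ∀ (f : HalfPlane → ℂ) (w : ℂ), 0 < w.re →
      ext (f ∘ affineMap a b ha hb) w = ext f (a * w + b) := by
    intro f w hw
    rw [ext_apply _ hw]
    exact (ext_apply f (affineMap a b ha hb ⟨w, hw⟩).2).symm
  have hpos : ∀ w : ℂ, 0 < w.re → 0 < (a * w + b : ℂ).re := fun w hw =>
    (affineMap a b ha hb ⟨w, hw⟩).2
  have hline : ∀ (f : HalfPlane → ℂ) (x : ℝ), 0 < x → lineSq (ext (f ∘ affineMap a b ha hb)) x =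
      ENNReal.ofReal (1 / a) * lineSq (ext f) (a * x + b.re) := by
    intro f x hx
    unfold lineSq
    set g : ℝ → ℝ≥0∞ := fun y => ‖ext f ((a * x + b.re : ℝ) + y * Complex.I)‖ₑ ^ 2 with hg
    have h1 : ∀ y : ℝ, ‖ext (f ∘ affineMap a b ha hb) (x + y * Complex.I)‖ₑ ^ 2 =
        (fun y => g (y + b.im)) (a * y) := by
      intro y
      rw [hext _ _ (by simpa using hx), hg]
      dsimp only
      congr 3
      apply Complex.ext <;> simp
    simp only [h1]
    have h2 : ∫⁻ y, (fun y => g (y + b.im)) (a * y) =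
        ENNReal.ofReal (1 / a) * ∫⁻ y, g (y + b.im) := by
      have he := (Homeomorph.mulLeft₀ a ha.ne').measurableEmbedding
      have h3 := he.lintegral_map (μ := volume) (fun y => g (y + b.im))
      simp only [Homeomorph.coe_mulLeft₀] at h3
      rw [← h3, Real.map_volume_mul_left ha.ne', lintegral_smul_measure, abs_of_pos (inv_pos.2 ha)]
      simp
    rw [h2, lintegral_add_right_eq_self]
  refine ⟨Real.toNNReal (1 / a), fun f hf => ?_⟩
  have hle : hardySq (f ∘ affineMap a b ha hb) ≤ ENNReal.ofReal (1 / a) *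
      hardySq f := by
    refine iSup_le fun x => ?_
    have hx : 0 < a * (x : ℝ) + b.re := by have := mul_pos ha x.2; linarith
    rw [hline f x x.2, mul_left_comm]
    gcongr
    exact le_iSup (fun x : Ioi (0 : ℝ) => ENNReal.ofReal (1 / Real.pi) * lineSq (ext f) x)
      ⟨_, hx⟩
  refine ⟨⟨?_, hle.trans_lt (ENNReal.mul_lt_top ENNReal.coe_lt_top hf.2)⟩, hle⟩
  have hd : DifferentiableOn ℂ (fun w : ℂ => ext f (a * w + b)) {w | 0 < w.re} :=
    DifferentiableOn.comp (g := ext f) hf.1 (by fun_prop) fun w hw => hpos w hw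
  exact hd.congr fun w hw => hext f w hw

section Operators

variable {H : Type*} [NormedAddCommGroup H] [InnerProductSpace ℂ H]

/-- A conjugation: a conjugate-linear `C` with `C² = I` and `⟨C x, C y⟩ = ⟨y, x⟩`. -/
def IsConjugation (C : H →ₛₗ[starRingEnd ℂ] H) : Prop :=
  (∀ x, C (C x) = x) ∧ ∀ x y, inner ℂ (C x) (C y) = inner ℂ y x

/-- A bounded operator `T` is complex symmetric if `C T* C = T` for some conjugation `C`. -/
def IsComplexSymmetric [CompleteSpace H] (T : H →L[ℂ] H) : Prop :=
  ∃ C : H →ₛₗ[starRingEnd ℂ] H, IsConjugation C ∧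
    ∀ x, C (ContinuousLinearMap.adjoint T (C x)) = T x

end Operators

end HardyRHP

namespace HardyRHP

open MeasureTheory Set Filter Topology
open scoped ENNReal NNReal ComplexConjugate

/-! Everything is tested on the reproducing kernels `kernel w`, which span a dense subspace and
satisfy `kernel w z = c / (z + conj w)`. The adjoint of $T=C_\phi$ always sends $k_w$ to
$k_{\phi(w)}$, while the formula for the kernel gives $a\,T k_w = k_{\psi(w)}$ with $\psi(w)=(w+\bar
b)/a$ (`smul_affineOp_kernel`). Hence $aT^*=C_\psi$.

A conjugation is built by prescribing $k_w\mapsto\lambda(w)k_{\sigma(w)}$, where $\sigma$ is an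
involution of the half-plane compatible with the kernel (`exists_conjugation`). For $a=1$ take
$\sigma(w)=\bar w$ and $\lambda=1$. For $\operatorname{Re}b=0$ and $a\ne1$, the fixed point
$p=b/(1-a)$ of $\phi$ lies on the imaginary axis, and inversion in the unit circle about $p$
exchanges $\phi$ with $\phi^{-1}=\psi$.

If $a<1$ and $\operatorname{Re}b>0$, then $p$ is an interior attracting fixed point. Thus
$T^*k_p=k_p$, and complex symmetry would make $Ck_p\neq0$ a fixed vector of $T$. Iterating $\phi$
shows that fixed vectors of $T$ are constant, hence zero. The case $a>1$ reduces to this one through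
$aT^*=C_\psi$, whose slope is $1/a$.

The kernel is found without boundary values: invariance of the norm under $w\mapsto xw+iy$, up to
the factor $x$, gives a functional equation, and differentiating it gives a first-order ODE
(`kernel_ode`). -/

/-! ### Affine changes of variable and the Hardy norm. -/

theorem lineSq_comp_affineMap (a : ℝ) (b : ℂ) (ha : 0 < a) (hb : 0 ≤ b.re) (f : HalfPlane → ℂ)
    {x : ℝ} (hx : 0 < x) : lineSq (ext (f ∘ affineMap a b ha hb)) x =
      ENNReal.ofReal (1 / a) * lineSq (ext f) (a * x + b.re) := by
  unfold lineSq
  set g : ℝ → ℝ≥0∞ := fun y => ‖ext f ((a * x + b.re : ℝ) + y * Complex.I)‖ₑ ^ 2 with hg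
  have h1 : ∀ y : ℝ, ‖ext (f ∘ affineMap a b ha hb) (x + y * Complex.I)‖ₑ ^ 2 =
      (fun y => g (y + b.im)) (a * y) := by
    intro y
    have hw : 0 < ((x : ℂ) + y * Complex.I).re := by simpa using hx
    rw [ext_apply _ hw, Function.comp_apply,
      ← ext_apply f (affineMap a b ha hb ⟨(x : ℂ) + y * Complex.I, hw⟩).2, hg]
    dsimp only [affineMap]
    congr 3
    apply Complex.ext <;> simp
  simp only [h1]
  have h2 : ∫⁻ y, (fun y => g (y + b.im)) (a * y) =
      ENNReal.ofReal (1 / a) * ∫⁻ y, g (y + b.im) := by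
    have he := (Homeomorph.mulLeft₀ a ha.ne').measurableEmbedding
    have h3 := he.lintegral_map (μ := volume) (fun y => g (y + b.im))
    simp only [Homeomorph.coe_mulLeft₀] at h3
    rw [← h3, Real.map_volume_mul_left ha.ne', lintegral_smul_measure, abs_of_pos (inv_pos.2 ha)]
    simp
  rw [h2, lintegral_add_right_eq_self]

theorem hardySq_comp_affineMap_le (a : ℝ) (b : ℂ) (ha : 0 < a) (hb : 0 ≤ b.re)
    (f : HalfPlane → ℂ) :
    hardySq (f ∘ affineMap a b ha hb) ≤ ENNReal.ofReal (1 / a) * hardySq f := by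
  refine iSup_le fun x => ?_
  have hx : 0 < a * (x : ℝ) + b.re := by have := mul_pos ha x.2; linarith
  rw [lineSq_comp_affineMap a b ha hb f x.2, mul_left_comm]
  gcongr
  exact le_iSup (fun x : Ioi (0 : ℝ) => ENNReal.ofReal (1 / Real.pi) * lineSq (ext f) x)
    ⟨_, hx⟩

/-- The composition operator with symbol `w ↦ a w + b`. -/
noncomputable abbrev affineOp (a : ℝ) (b : ℂ) (ha : 0 < a) (hb : 0 ≤ b.re) : H2 →L[ℂ] H2 :=
  compOp (affineMap a b ha hb) (isBoundedSymbol_affineMap a b ha hb)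

theorem sq_norm_affineOp_le (a : ℝ) (b : ℂ) (ha : 0 < a) (hb : 0 ≤ b.re) (f : H2) :
    a * ‖affineOp a b ha hb f‖ ^ 2 ≤ ‖f‖ ^ 2 := by
  have h := hardySq_comp_affineMap_le a b ha hb f
  rw [← H2.ofReal_norm_sq, ← ENNReal.ofReal_mul (by positivity)] at h
  have h' : ENNReal.ofReal (‖affineOp a b ha hb f‖ ^ 2) ≤ ENNReal.ofReal (1 / a * ‖f‖ ^ 2) := by
    rw [H2.ofReal_norm_sq]; exact h
  rw [ENNReal.ofReal_le_ofReal_iff (by positivity)] at h'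
  calc a * ‖affineOp a b ha hb f‖ ^ 2 ≤ a * (1 / a * ‖f‖ ^ 2) := by gcongr
    _ = ‖f‖ ^ 2 := by field_simp

theorem affineMap_comp_eq_id {a : ℝ} {b : ℂ} (ha : 0 < a) (hb : b.re = 0) (w : HalfPlane) :
    affineMap a b ha hb.ge (affineMap a⁻¹ (-(b / a)) (inv_pos.2 ha) (by simp [hb]) w) = w := by
  have ha' : (a : ℂ) ≠ 0 := by exact_mod_cast ha.ne'
  apply Subtype.ext
  simp only [affineMap, Complex.ofReal_inv]
  field_simp
  ring

theorem affineOp_surjective {a : ℝ} {b : ℂ} (ha : 0 < a) (hb : b.re = 0) :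
    Function.Surjective (affineOp a b ha hb.ge) := by
  intro f
  refine ⟨affineOp a⁻¹ (-(b / a)) (inv_pos.2 ha) (by simp [hb]) f, ?_⟩
  ext w
  have ha' : (a : ℂ) ≠ 0 := by exact_mod_cast ha.ne'
  rw [compOp_apply, compOp_apply]
  congr 1
  apply Subtype.ext
  simp only [affineMap, Complex.ofReal_inv]
  field_simp
  ring

/-- When `b` is purely imaginary the inverse symbol is again affine of the same kind, so the norm
bound applied to both gives equality: $\sqrt a\,C_\phi$ is unitary. -/
theorem sq_norm_affineOp {a : ℝ} {b : ℂ} (ha : 0 < a) (hb : b.re = 0) (f : H2) :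
    a * ‖affineOp a b ha hb.ge f‖ ^ 2 = ‖f‖ ^ 2 := by
  refine le_antisymm (sq_norm_affineOp_le a b ha hb.ge f) ?_
  have h := sq_norm_affineOp_le a⁻¹ (-(b / a)) (inv_pos.2 ha) (by simp [hb])
    (affineOp a b ha hb.ge f)
  have hf : affineOp a⁻¹ (-(b / a)) (inv_pos.2 ha) (by simp [hb]) (affineOp a b ha hb.ge f) = f := by
    ext w
    rw [compOp_apply, compOp_apply, affineMap_comp_eq_id ha hb]
  rw [hf] at h
  calc ‖f‖ ^ 2 = a * (a⁻¹ * ‖f‖ ^ 2) := by field_simp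
    _ ≤ _ := by gcongr

theorem inner_affineOp {a : ℝ} {b : ℂ} (ha : 0 < a) (hb : b.re = 0) (f g : H2) :
    a * inner ℂ (affineOp a b ha hb.ge f) (affineOp a b ha hb.ge g) = inner ℂ f g := by
  let U : H2 →ₗᵢ[ℂ] H2 := ⟨(((Real.sqrt a : ℝ) : ℂ) • affineOp a b ha hb.ge : H2 →L[ℂ] H2), by
    intro f
    rw [← sq_eq_sq₀ (norm_nonneg _) (norm_nonneg _), ← sq_norm_affineOp ha hb f]
    simp [norm_smul, mul_pow, abs_of_nonneg (Real.sqrt_nonneg a), Real.sq_sqrt ha.le]⟩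
  have h := U.inner_map_map f g
  have hs : ((Real.sqrt a : ℝ) : ℂ) * ((Real.sqrt a : ℝ) : ℂ) = a := by
    rw [← Complex.ofReal_mul, Real.mul_self_sqrt ha.le]
  rw [← h, ← hs]
  change _ = inner ℂ (((Real.sqrt a : ℝ) : ℂ) • affineOp a b ha hb.ge f)
    (((Real.sqrt a : ℝ) : ℂ) • affineOp a b ha hb.ge g)
  rw [inner_smul_left, inner_smul_right, Complex.conj_ofReal]
  ring

/-! ### The reproducing kernel and its closed form. -/

/-- Evaluation at `w` as a bounded functional on `H²(ℂ₊)`. -/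
noncomputable def evalCLM (w : HalfPlane) : H2 →L[ℂ] ℂ :=
  LinearMap.mkContinuous (⟨⟨fun f => f w, fun _ _ => rfl⟩, fun _ _ => rfl⟩ : H2 →ₗ[ℂ] ℂ)
    (Real.sqrt Real.pi * (1 + 1 / ((w : ℂ).re / 2))) fun f => by
      refine (f.norm_apply_le w (half_pos w.2) (half_lt_self w.2)).trans (le_of_eq ?_)
      ring

/-- The reproducing kernel of `H²(ℂ₊)` at `w`. -/
noncomputable def kernel (w : HalfPlane) : H2 := (InnerProductSpace.toDual ℂ H2).symm (evalCLM w)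

theorem inner_kernel (w : HalfPlane) (f : H2) : inner ℂ (kernel w) f = f w :=
  InnerProductSpace.toDual_symm_apply

theorem conj_kernel_apply (z w : HalfPlane) : conj (kernel w z) = kernel z w := by
  rw [← inner_kernel, ← inner_kernel, inner_conj_symm]

theorem adjoint_compOp_kernel (φ : HalfPlane → HalfPlane) (hφ : IsBoundedSymbol φ) (w : HalfPlane) :
    ContinuousLinearMap.adjoint (compOp φ hφ) (kernel w) = kernel (φ w) := by
  refine ext_inner_right ℂ fun f => ?_
  rw [ContinuousLinearMap.adjoint_inner_left, inner_kernel, inner_kernel, compOp_apply]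

/-- Covariance of the kernel under automorphisms: since $\sqrt a\,C_\phi$ is unitary, $a\,C_\phi
k_{\phi(w)}$ represents evaluation at `w`. -/
theorem mul_kernel_affineMap {a : ℝ} {b : ℂ} (ha : 0 < a) (hb : b.re = 0) (z w : HalfPlane) :
    a * kernel (affineMap a b ha hb.ge w) (affineMap a b ha hb.ge z) = kernel w z := by
  have h : (a : ℂ) • affineOp a b ha hb.ge (kernel (affineMap a b ha hb.ge w)) = kernel w := by
    refine ext_inner_right ℂ fun f => ?_
    obtain ⟨g, rfl⟩ := affineOp_surjective ha hb f
    rw [inner_smul_left, Complex.conj_ofReal, inner_affineOp ha hb, inner_kernel, inner_kernel,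
      compOp_apply]
  rw [← h]; rfl

/-- The point `1` of the half-plane. -/
def onePt : HalfPlane := ⟨1, by simp⟩

/-- The automorphism $w\mapsto xw+iy$ sends $1$ to $x+iy$ and $(1-iy)/x$ to $1$. Covariance and
Hermitian symmetry therefore relate the single function $k_1$ to itself at two points. -/
theorem kernel_functional_equation {x y : ℝ} (hx : 0 < x) :
    conj (ext (kernel onePt) (x + y * Complex.I)) =
      (x : ℂ)⁻¹ * ext (kernel onePt) ((1 - y * Complex.I) / x) := by
  have hx' : (x : ℂ) ≠ 0 := by exact_mod_cast hx.ne'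
  have hu : 0 < ((x : ℂ) + y * Complex.I).re := by simpa using hx
  have hv : 0 < ((1 - y * Complex.I) / x : ℂ).re := by
    rw [Complex.div_ofReal_re]; simpa using hx
  have h := mul_kernel_affineMap (b := y * Complex.I) hx (by simp)
    ⟨(1 - y * Complex.I) / x, hv⟩ onePt
  have h1 : affineMap x (y * Complex.I) hx (by simp) onePt = ⟨_, hu⟩ :=
    Subtype.ext (by simp [affineMap, onePt])
  have h2 : affineMap x (y * Complex.I) hx (by simp) ⟨(1 - y * Complex.I) / x, hv⟩ = onePt :=
    Subtype.ext (by simp only [affineMap, onePt]; field_simp; ring)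
  rw [h1, h2] at h
  rw [ext_apply _ hu, ext_apply _ hv, conj_kernel_apply, ← h]
  field_simp

theorem hasDerivAt_ext (f : H2) {z : ℂ} (hz : 0 < z.re) :
    HasDerivAt (ext f) (deriv (ext f) z) z :=
  (f.hol.differentiableAt (isOpen_re_pos.mem_nhds hz)).hasDerivAt

/-- The functional equation is differentiated in `x` and in `y`. By holomorphy both derivatives of
the left side come from the same complex number `d`; eliminating it leaves an equation at the one
point `ζ`, which says $((\zeta+1)k_1(\zeta))'=0$. -/
theorem kernel_ode {ζ : ℂ} (hζ : 0 < ζ.re) :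
    ext (kernel onePt) ζ + (ζ + 1) * deriv (ext (kernel onePt)) ζ = 0 := by
  obtain ⟨x, y, hx, rfl⟩ : ∃ x y : ℝ, 0 < x ∧ ζ = (1 - y * Complex.I) / x := by
    refine ⟨ζ.re⁻¹, -(ζ.im / ζ.re), inv_pos.2 hζ, ?_⟩
    have : (ζ.re : ℂ) ≠ 0 := by exact_mod_cast hζ.ne'
    push_cast
    field_simp
    rw [sub_neg_eq_add]
    exact (Complex.re_add_im ζ).symm
  have hx' : (x : ℂ) ≠ 0 := by exact_mod_cast hx.ne'
  have hu : 0 < ((x : ℂ) + y * Complex.I).re := by simpa using hx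
  set G := ext (kernel onePt) with hG
  have hGu := hasDerivAt_ext (kernel onePt) hu
  have hGz := hasDerivAt_ext (kernel onePt) hζ
  rw [← hG] at hGu hGz
  set d := deriv G (x + y * Complex.I)
  set e := deriv G ((1 - y * Complex.I) / x)
  have hxL : HasDerivAt (fun t : ℝ => conj (G (t + y * Complex.I))) (conj d) x := by
    have h1 : HasDerivAt (fun t : ℝ => (t : ℂ) + y * Complex.I) 1 x :=
      (Complex.ofRealCLM.hasDerivAt (x := x)).add_const _
    have h2 : HasDerivAt (fun t : ℝ => G (t + y * Complex.I)) (d * 1) x := HasDerivAt.comp (h₂ := G) x hGu h1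
    simpa using h2.star
  have hyL : HasDerivAt (fun t : ℝ => conj (G (x + t * Complex.I))) (conj (d * Complex.I)) y := by
    have h1 : HasDerivAt (fun t : ℝ => (x : ℂ) + t * Complex.I) (1 * Complex.I) y :=
      ((Complex.ofRealCLM.hasDerivAt (x := y)).mul_const _).const_add _
    have h2 : HasDerivAt (fun t : ℝ => G (x + t * Complex.I)) (d * (1 * Complex.I)) y :=
      HasDerivAt.comp (h₂ := G) y hGu h1
    simpa using h2.star
  have hinv : HasDerivAt (fun t : ℝ => (t : ℂ)⁻¹) (-1 / (x : ℂ) ^ 2) x := by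
    have h0 : HasDerivAt (fun t : ℝ => (t : ℂ)) 1 x := Complex.ofRealCLM.hasDerivAt (x := x)
    exact h0.fun_inv hx'
  have hxR : HasDerivAt (fun t : ℝ => (t : ℂ)⁻¹ * G ((1 - y * Complex.I) / t))
      (-1 / (x : ℂ) ^ 2 * G ((1 - y * Complex.I) / x) +
        (x : ℂ)⁻¹ * (e * ((1 - y * Complex.I) * (-1 / (x : ℂ) ^ 2)))) x := by
    have h1 : HasDerivAt (fun t : ℝ => (1 - y * Complex.I) / (t : ℂ))
        ((1 - y * Complex.I) * (-1 / (x : ℂ) ^ 2)) x := by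
      simpa only [div_eq_mul_inv] using hinv.const_mul (1 - y * Complex.I)
    have h2 : HasDerivAt (fun t : ℝ => G ((1 - y * Complex.I) / (t : ℂ))) _ x := HasDerivAt.comp (h₂ := G) x hGz h1
    exact hinv.mul h2
  have hyR : HasDerivAt (fun t : ℝ => (x : ℂ)⁻¹ * G ((1 - t * Complex.I) / x))
      ((x : ℂ)⁻¹ * (e * (-(1 * Complex.I) / x))) y := by
    have h1 : HasDerivAt (fun t : ℝ => (1 - t * Complex.I) / (x : ℂ))
        (-(1 * Complex.I) / x) y :=
      (((Complex.ofRealCLM.hasDerivAt (x := y)).mul_const Complex.I).const_sub 1).div_const _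
    have h2 : HasDerivAt (fun t : ℝ => G ((1 - t * Complex.I) / (x : ℂ))) _ y := HasDerivAt.comp (h₂ := G) y hGz h1
    exact h2.const_mul _
  have ex := hxL.unique (hxR.congr_of_eventuallyEq (by
    filter_upwards [lt_mem_nhds hx] with t ht
    exact kernel_functional_equation ht))
  have ey := hyL.unique (hyR.congr_of_eventuallyEq
    (Eventually.of_forall fun t => kernel_functional_equation hx))
  -- The `y`-derivative of the left side is $-i$ times its `x`-derivative, so `ex` removes `conj d`
  -- from `ey`.
  rw [map_mul, Complex.conj_I, ex] at ey
  have hI := Complex.I_sq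
  have key : (x : ℂ)⁻¹ ^ 2 * (G ((1 - y * Complex.I) / x) + ((1 - y * Complex.I) / x + 1) * e) = 0 := by
    have : Complex.I * ((x : ℂ)⁻¹ ^ 2 *
        (G ((1 - y * Complex.I) / x) + ((1 - y * Complex.I) / x + 1) * e)) = 0 := by
      linear_combination ey
    simpa using this
  simpa [hx'] using key

theorem kernel_onePt_eq (z : HalfPlane) :
    kernel onePt z * (z + 1) = kernel onePt onePt * 2 := by
  have hd : ∀ w : ℂ, 0 < w.re → HasDerivAt (fun w => (w + 1) * ext (kernel onePt) w) 0 w := by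
    intro w hw
    have h := ((hasDerivAt_id w).add_const (1 : ℂ)).mul (hasDerivAt_ext (kernel onePt) hw)
    refine h.congr_deriv ?_
    rw [← kernel_ode hw]; simp
  have hpc : IsPreconnected {w : ℂ | 0 < w.re} :=
    (convex_halfSpace_re_gt 0).isPreconnected
  have h := isOpen_re_pos.is_const_of_deriv_eq_zero hpc
    (fun w hw => (hd w hw).differentiableAt.differentiableWithinAt)
    (fun w hw => (hd w hw).deriv) z.2 onePt.2
  rw [ext_coe, ext_coe] at h
  rw [mul_comm, h]
  simp only [onePt]; ring

/-- The constant in `kernel w z = c / (z + conj w)`. -/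
noncomputable def kernelConst : ℂ := kernel onePt onePt * 2

theorem add_conj_ne_zero (z w : HalfPlane) : (z : ℂ) + conj (w : ℂ) ≠ 0 := by
  intro h
  have h1 := congrArg Complex.re h
  have := z.2
  have := w.2
  simp at h1
  linarith

/-- With $w=x+iy$, covariance under $z\mapsto xz+iy$ carries the formula for $k_1$ to $k_w$. The
value of the constant is never needed. -/
theorem kernel_apply (w z : HalfPlane) : kernel w z = kernelConst / (z + conj (w : ℂ)) := by
  obtain ⟨⟨x, y⟩, hx⟩ := w
  replace hx : 0 < x := hx
  have hx' : (x : ℂ) ≠ 0 := by exact_mod_cast hx.ne'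
  have hv : 0 < (((z : ℂ) - y * Complex.I) / x : ℂ).re := by
    rw [Complex.div_ofReal_re]; exact div_pos (by simpa using z.2) hx
  have h := mul_kernel_affineMap (b := y * Complex.I) hx (by simp) ⟨_, hv⟩ onePt
  have h1 : affineMap x (y * Complex.I) hx (by simp) onePt = ⟨⟨x, y⟩, hx⟩ :=
    Subtype.ext (by simp [affineMap, onePt, Complex.mk_eq_add_mul_I])
  have h2 : affineMap x (y * Complex.I) hx (by simp) ⟨_, hv⟩ = z :=
    Subtype.ext (by simp only [affineMap]; field_simp; ring)
  rw [h1, h2] at h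
  have h3 := kernel_onePt_eq ⟨_, hv⟩
  rw [← h] at h3
  rw [eq_div_iff (add_conj_ne_zero _ _), kernelConst, ← h3]
  simp only [Complex.mk_eq_add_mul_I, map_add, map_mul, Complex.conj_ofReal, Complex.conj_I]
  field_simp
  ring

/-! ### Nonvanishing and density of the kernels. -/

/-- A zero-free element of the space, since $|x+1+iy|^2\ge1+y^2$ for $x>0$. It shows that no point
evaluation vanishes identically. -/
theorem inv_add_one_mem : (fun z : HalfPlane => ((z : ℂ) + 1)⁻¹) ∈ hardySubmodule := by
  have hne : ∀ w : ℂ, 0 < w.re → w + 1 ≠ 0 := fun w hw h => by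
    have := congrArg Complex.re h
    simp at this
    linarith
  constructor
  · have hd : DifferentiableOn ℂ (fun w : ℂ => (w + 1)⁻¹) {w | 0 < w.re} := fun w hw =>
      (((differentiableAt_id.add_const (1 : ℂ)).inv (hne w hw))).differentiableWithinAt
    exact hd.congr fun w hw => ext_apply _ hw
  · have hb : ∀ x : Ioi (0 : ℝ), lineSq (ext fun z : HalfPlane => ((z : ℂ) + 1)⁻¹) x ≤
        ∫⁻ y : ℝ, ENNReal.ofReal ((1 + y ^ 2)⁻¹) := by
      intro x
      have hx : (0 : ℝ) < x := x.2
      refine lintegral_mono fun y => ?_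
      have hu : 0 < (((x : ℝ) : ℂ) + y * Complex.I).re := by simpa using hx
      rw [ext_apply _ hu, ← ofReal_norm, ← ENNReal.ofReal_pow (norm_nonneg _)]
      refine ENNReal.ofReal_le_ofReal ?_
      rw [norm_inv, inv_pow, ← Complex.normSq_eq_norm_sq, Complex.normSq_apply]
      gcongr
      · simp
        nlinarith
      · simp [sq]
    have hfin : ∫⁻ y : ℝ, ENNReal.ofReal ((1 + y ^ 2)⁻¹) < ⊤ :=
      integrable_inv_one_add_sq.lintegral_lt_top
    refine lt_of_le_of_lt (iSup_le fun x => ?_)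
      (ENNReal.mul_lt_top (ENNReal.ofReal_lt_top (r := 1 / Real.pi)) hfin)
    gcongr
    exact hb x

theorem kernel_ne_zero (w : HalfPlane) : kernel w ≠ 0 := by
  intro h
  have h1 := inner_kernel w (H2.mk _ inv_add_one_mem)
  rw [h, inner_zero_left, H2.coe_mk] at h1
  have h2 := inv_eq_zero.1 h1.symm
  have := congrArg Complex.re h2
  have := w.2
  simp at *
  linarith

theorem dense_span_kernel : Dense (Submodule.span ℂ (range kernel) : Set H2) := by
  rw [Submodule.dense_iff_topologicalClosure_eq_top, Submodule.topologicalClosure_eq_top_iff,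
    Submodule.eq_bot_iff]
  intro f hf
  ext w
  rw [← inner_kernel w f]
  exact (Submodule.mem_orthogonal _ _).1 hf _ (Submodule.subset_span ⟨w, rfl⟩)

/-! ### Conjugations prescribed on the kernels. -/

/-- A semilinear extension of `w ↦ ψ w` to finite formal combinations. -/
noncomputable def conjCombination {ι H : Type*} [AddCommGroup H] [Module ℂ H] (ψ : ι → H) :
    (ι →₀ ℂ) →ₛₗ[starRingEnd ℂ] H where
  toFun x := x.sum fun i c => conj c • ψ i
  map_add' x y := Finsupp.sum_add_index' (by simp) (by simp [add_smul])
  map_smul' c x := by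
    rw [Finsupp.sum_smul_index (by simp), Finsupp.smul_sum]
    simp [mul_smul]

theorem inner_conjCombination {ι H : Type*} [NormedAddCommGroup H] [InnerProductSpace ℂ H]
    {ψ k : ι → H} (h : ∀ i j, inner ℂ (ψ i) (ψ j) = inner ℂ (k j) (k i)) (x y : ι →₀ ℂ) :
    inner ℂ (conjCombination ψ x) (conjCombination ψ y) =
      inner ℂ (Finsupp.linearCombination ℂ k y) (Finsupp.linearCombination ℂ k x) := by
  simp only [conjCombination, LinearMap.coe_mk, AddHom.coe_mk, Finsupp.linearCombination_apply,
    Finsupp.sum, sum_inner, inner_sum, inner_smul_left, inner_smul_right, h, Complex.conj_conj,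
    Finset.mul_sum]
  rw [Finset.sum_comm]
  refine Finset.sum_congr rfl fun i _ => Finset.sum_congr rfl fun j _ => ?_
  ring

/-- An involution `σ` of the half-plane and a multiplier `lam` compatible with the kernel induce
a conjugation. -/
theorem exists_conjugation {σ : HalfPlane → HalfPlane} {lam : HalfPlane → ℂ}
    (hσ : ∀ w, σ (σ w) = w) (hlam : ∀ w, conj (lam w) * lam (σ w) = 1)
    (hG : ∀ w v, conj (lam w) * lam v * kernel (σ v) (σ w) = kernel w v) :
    ∃ C : H2 →ₛₗ[starRingEnd ℂ] H2, IsConjugation C ∧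
      ∀ w, C (kernel w) = lam w • kernel (σ w) := by
  set e := Finsupp.linearCombination ℂ kernel with he
  set ψ : HalfPlane → H2 := fun w => lam w • kernel (σ w) with hψ
  set f := conjCombination ψ with hf
  have hin : ∀ x y, inner ℂ (f x) (f y) = inner ℂ (e y) (e x) := by
    refine inner_conjCombination fun w v => ?_
    rw [hψ, inner_smul_left, inner_smul_right, inner_kernel, inner_kernel, ← hG w v]
    ring
  have hnorm : ∀ x, ‖f x‖ = ‖e x‖ := by
    intro x
    rw [norm_eq_sqrt_re_inner (𝕜 := ℂ), norm_eq_sqrt_re_inner (𝕜 := ℂ), hin]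
  -- `hG` says that the Gram matrix of `ψ` is the transpose of that of the kernels. So `f` and `e`
  -- have equal norms, and `f` descends through `e` to a well-defined isometry whatever linear
  -- relations the kernels satisfy.
  have hbd : ∃ B : ℝ, ∀ x, ‖f x‖ ≤ B * ‖e x‖ := ⟨1, fun x => by rw [hnorm, one_mul]⟩
  have hde : DenseRange e := by
    have h := dense_span_kernel
    rw [← Finsupp.range_linearCombination] at h
    rwa [LinearMap.coe_range] at h
  set C := f.extendOfNorm e with hC
  have hCe : ∀ x, C (e x) = f x := LinearMap.extendOfNorm_eq hde hbd
  have hCk : ∀ w, C (kernel w) = lam w • kernel (σ w) := by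
    intro w
    have h := hCe (Finsupp.single w 1)
    simpa [he, hf, hψ, conjCombination] using h
  refine ⟨C, ⟨?_, ?_⟩, hCk⟩
  · have h : (C.comp C : H2 →L[ℂ] H2) = ContinuousLinearMap.id ℂ H2 := by
      refine ContinuousLinearMap.ext_on dense_span_kernel ?_
      rintro _ ⟨w, rfl⟩
      rw [ContinuousLinearMap.comp_apply, hCk, map_smulₛₗ, hCk, hσ, smul_smul, hlam, one_smul]
      rfl
    exact fun x => DFunLike.congr_fun h x
  · refine hde.induction_on₂ ?_ ?_
    · exact isClosed_eq (by simp only [ContinuousLinearMap.coe_coe]; fun_prop) (by fun_prop)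
    · intro x y
      simp only [ContinuousLinearMap.coe_coe, hCe, hin]

theorem IsConjugation.inner_right {H : Type*} [NormedAddCommGroup H] [InnerProductSpace ℂ H]
    {C : H →ₛₗ[starRingEnd ℂ] H} (hC : IsConjugation C) (x y : H) :
    inner ℂ x (C y) = inner ℂ y (C x) := by
  simpa only [hC.1] using hC.2 (C x) y

/-- Pairing $CT^*Cf$ with $k_w$ moves all operators onto $k_w$, so the identity only has to be known
there. -/
theorem isComplexSymmetric_of_kernel {T : H2 →L[ℂ] H2} {C : H2 →ₛₗ[starRingEnd ℂ] H2}
    (hC : IsConjugation C)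
    (h : ∀ w, C (T (C (kernel w))) = ContinuousLinearMap.adjoint T (kernel w)) :
    IsComplexSymmetric T := by
  refine ⟨C, hC, fun f => ?_⟩
  ext w
  have h' : T (C (kernel w)) = C (ContinuousLinearMap.adjoint T (kernel w)) := by
    rw [← h, hC.1]
  rw [← inner_kernel, ← inner_kernel, hC.inner_right, ContinuousLinearMap.adjoint_inner_left, h',
    hC.2, ContinuousLinearMap.adjoint_inner_left]

/-! ### Affine operators on kernels, and the complex symmetric cases. -/

/-- Factor `a` out of the denominator $az+b+\bar v$. -/
theorem smul_affineOp_kernel {a : ℝ} {b : ℂ} (ha : 0 < a) (hb : 0 ≤ b.re) (v : HalfPlane) :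
    (a : ℂ) • affineOp a b ha hb (kernel v) =
      kernel (affineMap a⁻¹ (conj b / a) (inv_pos.2 ha)
        (by rw [Complex.div_ofReal_re]; exact div_nonneg hb ha.le) v) := by
  have ha' : (a : ℂ) ≠ 0 := by exact_mod_cast ha.ne'
  ext z
  rw [H2.coe_smul, Pi.smul_apply, compOp_apply, kernel_apply, kernel_apply]
  have h1 := add_conj_ne_zero (affineMap a b ha hb z) v
  simp only [affineMap, smul_eq_mul, map_add, map_mul, map_div₀, Complex.conj_conj,
    Complex.conj_ofReal, Complex.ofReal_inv, map_inv₀] at h1 ⊢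
  have h2 : (z : ℂ) + ((a : ℂ)⁻¹ * conj (v : ℂ) + b / a) = (a * z + b + conj (v : ℂ)) / a := by
    field_simp
    ring
  rw [h2]
  field_simp

theorem smul_adjoint_affineOp {a : ℝ} {b : ℂ} (ha : 0 < a) (hb : 0 ≤ b.re) (f : H2) :
    (a : ℂ) • ContinuousLinearMap.adjoint (affineOp a b ha hb) f =
      affineOp a⁻¹ (conj b / a) (inv_pos.2 ha)
        (by rw [Complex.div_ofReal_re]; exact div_nonneg hb ha.le) f := by
  ext w
  rw [compOp_apply, ← inner_kernel, ← inner_kernel, ← smul_affineOp_kernel, inner_smul_right,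
    ContinuousLinearMap.adjoint_inner_right, inner_smul_left, Complex.conj_ofReal]

/-- With $Ck_w=k_{\bar w}$, both $CTCk_w$ and $T^*k_w$ equal $k_{w+b}$. -/
theorem isComplexSymmetric_translation {b : ℂ} (hb : 0 ≤ b.re) :
    IsComplexSymmetric (affineOp 1 b one_pos hb) := by
  obtain ⟨C, hC, hCk⟩ := exists_conjugation
    (σ := fun w => ⟨conj (w : ℂ), by simpa using w.2⟩) (lam := fun _ => 1)
    (fun w => Subtype.ext (by simp)) (by simp)
    (fun w v => by simp only [kernel_apply, map_one, one_mul, Complex.conj_conj]; rw [add_comm])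
  refine isComplexSymmetric_of_kernel hC fun w => ?_
  have h := smul_affineOp_kernel one_pos hb ⟨conj (w : ℂ), by simpa using w.2⟩
  replace h := (one_smul ℂ _).symm.trans h
  rw [hCk, one_smul, h, hCk, one_smul, adjoint_compOp_kernel]
  congr 1
  apply Subtype.ext
  simp [affineMap]

theorem isComplexSymmetric_of_re_eq_zero {a : ℝ} {b : ℂ} (ha : 0 < a) (ha1 : a ≠ 1)
    (hb : b.re = 0) : IsComplexSymmetric (affineOp a b ha hb.ge) := by
  have ha' : (a : ℂ) ≠ 0 := by exact_mod_cast ha.ne'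
  have ha1' : (1 - a : ℂ) ≠ 0 := by
    intro h
    exact ha1 (by exact_mod_cast (sub_eq_zero.1 h).symm)
  set p : ℂ := b / (1 - a) with hp
  have hpr : p.re = 0 := by
    rw [hp, show (1 - a : ℂ) = ((1 - a : ℝ) : ℂ) by push_cast; rfl, Complex.div_ofReal_re, hb,
      zero_div]
  have hpc : conj p = -p := Complex.ext (by simp [hpr]) (by simp)
  have hbc : conj b = -b := Complex.ext (by simp [hb]) (by simp)
  have hbp : b = p * (1 - a) := by rw [hp]; field_simp
  have hre : ∀ w : HalfPlane, 0 < ((w : ℂ) - p).re := fun w => by simpa [hpr] using w.2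
  have hne : ∀ w : HalfPlane, (w : ℂ) - p ≠ 0 := fun w h => by
    have := hre w
    simp [h] at this
  have hnc : ∀ w : HalfPlane, conj (w : ℂ) + p ≠ 0 := fun w h => by
    refine hne w (star_injective ?_)
    simpa [hpc] using h
  -- As $\bar p=-p$, this is $p+1/\overline{(w-p)}$, inversion in the unit circle about `p`.
  let σ : HalfPlane → HalfPlane := fun w => ⟨p + (conj (w : ℂ) + p)⁻¹, by
    have h1 : 0 < (conj (w : ℂ) + p).re := by simpa [hpr] using w.2
    rw [Complex.add_re, hpr, zero_add, Complex.inv_re]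
    exact div_pos h1 (Complex.normSq_pos.2 (hnc w))⟩
  have hσc : ∀ w, conj (σ w : ℂ) = -p + ((w : ℂ) - p)⁻¹ := by
    intro w
    simp [σ, hpc, sub_eq_add_neg]
  obtain ⟨C, hC, hCk⟩ := exists_conjugation (σ := σ) (lam := fun w => ((w : ℂ) - p)⁻¹)
    (fun w => by
      apply Subtype.ext
      change p + (conj (σ w : ℂ) + p)⁻¹ = w
      rw [hσc]
      simp)
    (fun w => by
      have := hnc w
      simp only [σ, map_inv₀, map_sub, hpc, sub_neg_eq_add, add_sub_cancel_left, inv_inv]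
      field_simp)
    (fun w v => by
      have h1 := hnc w
      have h2 := hne v
      have h3 := add_conj_ne_zero v w
      have h4 : (σ w : ℂ) + conj (σ v : ℂ) =
          (v + conj (w : ℂ)) / ((conj (w : ℂ) + p) * (v - p)) := by
        rw [hσc]
        simp only [σ]
        field_simp
        ring
      rw [kernel_apply, kernel_apply, h4]
      simp only [map_inv₀, map_sub, hpc, sub_neg_eq_add]
      field_simp)
  refine isComplexSymmetric_of_kernel hC fun w => ?_
  have h := smul_affineOp_kernel ha hb.ge (σ w)
  rw [← eq_inv_smul_iff₀ ha'] at h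
  have h1 := hnc w
  rw [hCk, map_smul, h, map_smulₛₗ, map_smulₛₗ, hCk, adjoint_compOp_kernel, smul_smul, smul_smul]
  -- Since $\bar b=-b$, the symbol here is $\phi^{-1}$; as $\phi(w)-p=a(w-p)$, the equality says
  -- $\phi^{-1}(\sigma(w))=\sigma(\phi(w))$.
  have hu : ((affineMap a⁻¹ (conj b / a) (inv_pos.2 ha)
      (by simp [hb]) (σ w) : HalfPlane) : ℂ) - p = (a * (conj (w : ℂ) + p))⁻¹ := by
    simp only [affineMap, σ, hbc, Complex.ofReal_inv]
    rw [hbp]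
    field_simp
    ring
  have hcoef : conj ((w : ℂ) - p)⁻¹ * conj (a : ℂ)⁻¹ * ((affineMap a⁻¹ (conj b / a) (inv_pos.2 ha)
      (by simp [hb]) (σ w) : ℂ) - p)⁻¹ = 1 := by
    rw [hu]
    simp only [map_inv₀, map_sub, hpc, sub_neg_eq_add, Complex.conj_ofReal, inv_inv]
    field_simp
  rw [hcoef, one_smul]
  congr 1
  apply Subtype.ext
  change p + (conj (affineMap a⁻¹ (conj b / a) _ _ (σ w) : ℂ) + p)⁻¹ = a * w + b
  have hu' := congrArg conj hu
  simp only [map_sub, map_inv₀, map_mul, map_add, Complex.conj_ofReal, Complex.conj_conj, hpc,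
    sub_neg_eq_add] at hu'
  rw [hu', inv_inv, hbp]
  ring

/-! ### Failure of complex symmetry for `a ≠ 1` and `Re b > 0`. -/

/-- A constant is unchanged by $w\mapsto2w$, yet composition with that map halves the squared norm.
-/
theorem H2.eq_zero_of_const {f : H2} {c : ℂ} (h : ∀ w, f w = c) : f = 0 := by
  have h1 := sq_norm_affineOp (b := 0) two_pos rfl f
  have h2 : affineOp 2 0 two_pos le_rfl f = f := by
    ext w
    rw [compOp_apply, h, h]
  rw [h2] at h1
  have h3 : ‖f‖ ^ 2 = 0 := by linarith
  simpa using h3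

/-- The iterates of the symbol converge to its fixed point `p` in the half-plane, so continuity
forces $f(w)=f(p)$ for every `w`. -/
theorem H2.eq_zero_of_comp_affineMap {a : ℝ} {b : ℂ} (ha : 0 < a) (ha1 : a < 1) (hb : 0 < b.re)
    {f : H2} (hf : affineOp a b ha hb.le f = f) : f = 0 := by
  have ha1' : (1 - a : ℂ) ≠ 0 := by
    intro h
    exact ha1.ne (by exact_mod_cast (sub_eq_zero.1 h).symm)
  set p : ℂ := b / (1 - a) with hp
  have hpr : 0 < p.re := by
    rw [hp, show (1 - a : ℂ) = ((1 - a : ℝ) : ℂ) by push_cast; rfl, Complex.div_ofReal_re]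
    exact div_pos hb (by linarith)
  have hbp : b = p * (1 - a) := by rw [hp]; field_simp
  have hfw : ∀ w, f (affineMap a b ha hb.le w) = f w := fun w => by
    rw [← compOp_apply _ (isBoundedSymbol_affineMap a b ha hb.le), hf]
  refine H2.eq_zero_of_const (c := HardyRHP.ext f p) fun w => ?_
  have hiter : ∀ n : ℕ, f ((affineMap a b ha hb.le)^[n] w) = f w := by
    intro n
    induction n with
    | zero => rfl
    | succ n ih => rw [Function.iterate_succ_apply', hfw, ih]
  have hval : ∀ n : ℕ, (((affineMap a b ha hb.le)^[n] w : HalfPlane) : ℂ) =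
      p + (a : ℂ) ^ n * (w - p) := by
    intro n
    induction n with
    | zero => simp
    | succ n ih =>
      rw [Function.iterate_succ_apply']
      change (a : ℂ) * _ + b = _
      rw [ih, hbp]
      ring
  have hlim : Tendsto (fun n : ℕ => p + (a : ℂ) ^ n * (w - p)) atTop (𝓝 p) := by
    have h := tendsto_pow_atTop_nhds_zero_of_norm_lt_one (x := (a : ℂ))
      (by simpa [abs_of_pos ha] using ha1)
    simpa using (h.mul_const ((w : ℂ) - p)).const_add p
  have hc := ((hasDerivAt_ext f hpr).continuousAt.tendsto.comp hlim)
  refine tendsto_nhds_unique (tendsto_const_nhds (x := f w)) (hc.congr fun n => ?_)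
  rw [Function.comp_apply, ← hval, ext_coe, hiter]

theorem not_isComplexSymmetric_of_lt_one {a : ℝ} {b : ℂ} (ha : 0 < a) (ha1 : a < 1)
    (hb : 0 < b.re) : ¬ IsComplexSymmetric (affineOp a b ha hb.le) := by
  rintro ⟨C, hC, h⟩
  have ha1' : (1 - a : ℂ) ≠ 0 := by
    intro h
    exact ha1.ne (by exact_mod_cast (sub_eq_zero.1 h).symm)
  let p : HalfPlane := ⟨b / (1 - a), by
    rw [show (1 - a : ℂ) = ((1 - a : ℝ) : ℂ) by push_cast; rfl, Complex.div_ofReal_re]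
    exact div_pos hb (by linarith)⟩
  have hp : affineMap a b ha hb.le p = p := by
    apply Subtype.ext
    simp only [affineMap, p]
    field_simp
    ring
  -- Apply $T=CT^*C$ to $Ck_p$ and use $T^*k_p=k_{\phi(p)}=k_p$.
  have h1 : affineOp a b ha hb.le (C (kernel p)) = C (kernel p) := by
    rw [← h, hC.1, adjoint_compOp_kernel, hp]
  have h2 := congrArg C (H2.eq_zero_of_comp_affineMap ha ha1 hb h1)
  rw [hC.1, map_zero] at h2
  exact kernel_ne_zero p h2

/-- The same `C` works: $CT^*C=T$ is equivalent to $CTC=T^*$, and the scalar `r` is real. -/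
theorem IsComplexSymmetric.of_smul_adjoint {H : Type*} [NormedAddCommGroup H]
    [InnerProductSpace ℂ H] [CompleteSpace H] {S T : H →L[ℂ] H} (hT : IsComplexSymmetric T)
    {r : ℝ} (hS : S = (r : ℂ) • ContinuousLinearMap.adjoint T) : IsComplexSymmetric S := by
  obtain ⟨C, hC, h⟩ := hT
  refine ⟨C, hC, fun x => ?_⟩
  have hadj : ContinuousLinearMap.adjoint S = (r : ℂ) • T := by
    rw [hS, map_smulₛₗ, ContinuousLinearMap.adjoint_adjoint, Complex.conj_ofReal]
  rw [hadj, hS, _root_.smul_apply, _root_.smul_apply, map_smulₛₗ,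
    Complex.conj_ofReal, ← h, hC.1, hC.1]

end HardyRHP

theorem mainTheorem3 (a : ℝ) (b : ℂ) (ha : 0 < a) (hb : 0 ≤ b.re) :
    HardyRHP.IsComplexSymmetric
      (HardyRHP.compOp (HardyRHP.affineMap a b ha hb)
        (HardyRHP.isBoundedSymbol_affineMap a b ha hb)) ↔
      a = 1 ∨ b.re = 0 := by
  constructor
  · intro h
    by_contra! hne
    obtain ⟨ha1, hb0⟩ := hne
    have hb' : 0 < b.re := lt_of_le_of_ne hb (Ne.symm hb0)
    rcases lt_or_gt_of_ne ha1 with hlt | hgt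
    · exact HardyRHP.not_isComplexSymmetric_of_lt_one ha hlt hb' h
    -- For `a > 1`, pass to $aT^*$, whose symbol has slope $a^{-1}<1$ and translation part of
    -- positive real part.
    · refine HardyRHP.not_isComplexSymmetric_of_lt_one (b := starRingEnd ℂ b / a) (inv_pos.2 ha)
        (inv_lt_one_of_one_lt₀ hgt)
        (by rw [Complex.div_ofReal_re]; exact div_pos (by simpa using hb') ha)
        (h.of_smul_adjoint (r := a) ?_)
      ext1 f
      exact (HardyRHP.smul_adjoint_affineOp ha hb f).symm
  · rintro (rfl | hb0)
    · exact HardyRHP.isComplexSymmetric_translation hb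
    · rcases eq_or_ne a 1 with rfl | ha1
      · exact HardyRHP.isComplexSymmetric_translation hb
      · exact HardyRHP.isComplexSymmetric_of_re_eq_zero ha ha1 hb0
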